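/- Write $\hat\psi$ for the Fourier transform of $\psi\in L^2(\mathbb R)$ (complex-valued functions), normalized by $\hat\psi(\xi)=\int_{\mathbb R}\psi(x)e^{-2\pi i x\xi}\,dx$ for $\psi\in L^1(\mathbb R)\cap L^2(\mathbb R)$. A function $\psi\in L^2(\mathbb R)$ is an orthonormal wavelet if the functions $\psi_{j,k}(x)=2^{j/2}\psi(2^jx-k)$, $j,k\in\mathbb Z$, form an orthonormal basis of $L^2(\mathbb R)$. A multiresolution analysis (MRA) is a sequence $(V_j)_{j\in\mathbb Z}$ of closed subspaces of $L^2(\mathbb R)$ such that for all $j\in\mathbb Z$: $V_j\subset V_{j+1}$; $f(\cdot)\in V_j$ if and only if $f(2\,\cdot)\in V_{j+1}$; $\bigcap_{j}V_j=\{0\}$; $\overline{\bigcup_{j}V_j}=L^2(\mathbb R)$; and there is $\varphi\in V_0$ whose integer translates $(\varphi(\cdot-k))_{k\in\mathbb Z}$ form an orthonormal basis of $V_0$. An MRA wavelet is an orthonormal wavelet $\psi$ for which there is an MRA $(V_j)$ such that $\psi$ belongs to the orthogonal complement $V_1\ominus V_0$ of $V_0$ in $V_1$. A wavelet set is a measurable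 set $W\subset\mathbb R$ such that each of the families $\{W+k\}_{k\in\mathbb Z}$ and $\{2^jW\}_{j\in\mathbb Z}$ is a partition of $\mathbb R$ modulo Lebesgue null sets. **Theorem.** Suppose that $\psi\in L^2(\mathbb R)$ is an MRA wavelet. Then there exists a wavelet set $W$ such that $$W\subset\operatorname{supp}\hat\psi=\{\xi\in\mathbb R:\hat\psi(\xi)\neq0\},$$ whichever function is chosen to represent the class $\hat\psi\in L^2(\mathbb R)$ ($W$ may depend on this choice). -/

import Mathlib

open MeasureTheory
open scoped FourierTransform

noncomputable section

namespace WaveletTheory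

/-- The complex Hilbert space `L²(ℝ)`. -/
abbrev L2R : Type := Lp ℂ 2 (volume : Measure ℝ)

/-- Square-integrability is preserved by the affine substitution `x ↦ a x - b` with `a ≠ 0`. -/
theorem memLp_comp_affine (f : L2R) {a : ℝ} (ha : a ≠ 0) (b : ℝ) :
    MemLp (fun x : ℝ => f (a * x - b)) 2 volume := by
  have h1 : MemLp (fun x : ℝ => f (x - b)) 2 volume :=
    (Lp.memLp f).comp_measurePreserving (measurePreserving_sub_right volume b)
  have h2 : Measure.map (fun x : ℝ => a * x) volume = ENNReal.ofReal |a⁻¹| • volume :=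
    Real.map_volume_mul_left ha
  have h3 : MemLp (fun x : ℝ => f (x - b)) 2 (Measure.map (fun x : ℝ => a * x) volume) := by
    rw [h2]
    exact h1.smul_measure ENNReal.ofReal_ne_top
  exact h3.comp_of_map (measurable_const_mul a).aemeasurable

/-- The element `x ↦ f (a x - b)` of `L²(ℝ)`, for `f ∈ L²(ℝ)` and real `a ≠ 0`, `b`. -/
def affineComp (a : ℝ) (ha : a ≠ 0) (b : ℝ) (f : L2R) : L2R :=
  (memLp_comp_affine f ha b).toLp

theorem coeFn_affineComp (a : ℝ) (ha : a ≠ 0) (b : ℝ) (f : L2R) :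
    affineComp a ha b f =ᵐ[volume] fun x : ℝ => f (a * x - b) :=
  (memLp_comp_affine f ha b).coeFn_toLp

/-- The translate `f (· - b)`. -/
def translate (b : ℝ) (f : L2R) : L2R := affineComp 1 one_ne_zero b f

/-- The unnormalized dyadic dilate `f (2 ·)`. -/
def dilateTwo (f : L2R) : L2R := affineComp 2 two_ne_zero 0 f

/-- `ψ_{j,k}(x) = 2^{j/2} ψ(2^j x - k)`, indexed by `(j, k) ∈ ℤ × ℤ`. -/
def waveletSystem (ψ : L2R) (p : ℤ × ℤ) : L2R :=
  (((2 : ℝ) ^ ((p.1 : ℝ) / 2) : ℝ) : ℂ) •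
    affineComp ((2 : ℝ) ^ p.1) (zpow_ne_zero p.1 two_ne_zero) (p.2 : ℝ) ψ

/-- The family `e` is an orthonormal (Hilbert) basis of the closed subspace `V` of `L²(ℝ)`:
it is orthonormal and its closed linear span is `V`. -/
def IsONBasisOf {ι : Type*} (e : ι → L2R) (V : Submodule ℂ L2R) : Prop :=
  Orthonormal ℂ e ∧ (Submodule.span ℂ (Set.range e)).topologicalClosure = V

/-- `ψ` is an orthonormal dyadic wavelet. -/
def IsONWavelet (ψ : L2R) : Prop := IsONBasisOf (waveletSystem ψ) ⊤

/-- A multiresolution analysis of `L²(ℝ)`. -/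
structure IsMRA (V : ℤ → Submodule ℂ L2R) : Prop where
  isClosed : ∀ j, IsClosed (V j : Set L2R)
  mono : ∀ j, V j ≤ V (j + 1)
  mem_iff_dilate_mem : ∀ (j : ℤ) (f : L2R), f ∈ V j ↔ dilateTwo f ∈ V (j + 1)
  iInf_eq_bot : ⨅ j, V j = ⊥
  dense_iUnion : closure (⋃ j, (V j : Set L2R)) = Set.univ
  exists_scaling : ∃ φ ∈ V 0, IsONBasisOf (fun k : ℤ => translate (k : ℝ) φ) (V 0)

/-- `ψ` is an orthonormal wavelet associated with some multiresolution analysis `(V j)`, in the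
sense that `ψ` lies in the orthogonal complement of `V 0` inside `V 1`. -/
def IsMRAWavelet (ψ : L2R) : Prop :=
  IsONWavelet ψ ∧ ∃ V : ℤ → Submodule ℂ L2R, IsMRA V ∧ ψ ∈ V 1 ∧ ψ ∈ (V 0)ᗮ

/-- The family `P` of subsets of `ℝ` is a partition of `ℝ` modulo Lebesgue null sets. -/
def IsPartitionModNull {ι : Type*} (P : ι → Set ℝ) : Prop :=
  (∀ i j, i ≠ j → volume (P i ∩ P j) = 0) ∧ volume (⋃ i, P i)ᶜ = 0

/-- A wavelet set: a measurable set which tiles `ℝ`, modulo null sets, both by integer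
translations and by dyadic dilations. -/
structure IsWaveletSet (W : Set ℝ) : Prop where
  measurableSet : MeasurableSet W
  translation_tiling : IsPartitionModNull (fun k : ℤ => (fun x : ℝ => x + k) '' W)
  dilation_tiling : IsPartitionModNull (fun j : ℤ => (fun x : ℝ => (2 : ℝ) ^ j * x) '' W)

end WaveletTheory

end

noncomputable section

namespace WaveletTheory

open Filter Topology Set ComplexConjugate

/-! Let `p` and `h` be the Fourier transforms of a scaling function and of the wavelet. From each
coset of `ℤ`, select the point of least absolute value at which `p` does not vanish; these points
form a set `S` that tiles by integer translations (`leastSupport`). The two-scale relation gives `S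
⊆ 2S`, and the wavelet set is `W = 2S \ S`. A coset meets `2S` twice, at shifts of opposite parity,
and meets `S` once, hence meets `W` once. The sets `2 ^ n S` increase, exhaust the line by density
of the MRA, and have null intersection because `S` has measure at most one; hence `W` tiles by
dilations.

The inclusion in the support of `h` rests on `two_mul_mem_leastSupport`: if `x ∈ S` and `h (2x) =
0`, then `2x ∈ S`. Indeed `h` then vanishes on `2x + 2ℤ`. On `2x + 2ℤ + 1` the values of `p` and `h`
are proportional, so orthogonality of the two vectors over the coset makes `p` vanish there
(`eq_zero_of_bracket`). Only even shifts compete with `2x`, and these are doubles of the competitors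
of `x`.

Filters never appear: membership in `V 0` and `V 1` is used as cross-multiplied identities between
values on a coset. These need no division, define closed conditions in `L²`, and can be imposed
simultaneously at every point of an invariant conull set. -/

/-! ### Affine substitutions on `L²` and closed almost everywhere relations -/

theorem quasiMeasurePreserving_affine {a : ℝ} (ha : a ≠ 0) (b : ℝ) :
    Measure.QuasiMeasurePreserving (fun x : ℝ => a * x + b) volume volume := by
  have h1 : Measure.QuasiMeasurePreserving (fun x : ℝ => a * x) volume volume := by
    refine ⟨measurable_const_mul a, ?_⟩
    rw [Real.map_volume_mul_left ha]
    exact Measure.smul_absolutelyContinuous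
  exact (measurePreserving_add_right volume b).quasiMeasurePreserving.comp h1

theorem ae_comp_affine {P : ℝ → Prop} (h : ∀ᵐ x, P x) {a : ℝ} (ha : a ≠ 0) (b : ℝ) :
    ∀ᵐ x : ℝ, P (a * x + b) :=
  (quasiMeasurePreserving_affine ha b).ae h

/-- The substitution `f ↦ f (a · - b)` as a linear map of `L²(ℝ)`. -/
def affineCompLM (a : ℝ) (ha : a ≠ 0) (b : ℝ) : L2R →ₗ[ℂ] L2R where
  toFun := affineComp a ha b
  map_add' f g := by
    refine Lp.ext ?_
    have h := ae_comp_affine (Lp.coeFn_add f g) ha (-b)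
    filter_upwards [coeFn_affineComp a ha b (f + g), coeFn_affineComp a ha b f,
      coeFn_affineComp a ha b g, Lp.coeFn_add (affineComp a ha b f) (affineComp a ha b g), h]
      with x h1 h2 h3 h4 h5
    rw [h1, h4, Pi.add_apply, h2, h3, sub_eq_add_neg, h5, Pi.add_apply]
  map_smul' c f := by
    refine Lp.ext ?_
    have h := ae_comp_affine (Lp.coeFn_smul c f) ha (-b)
    filter_upwards [coeFn_affineComp a ha b (c • f), coeFn_affineComp a ha b f,
      Lp.coeFn_smul c (affineComp a ha b f), h] with x h1 h2 h4 h5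
    rw [RingHom.id_apply, h1, h4, Pi.smul_apply, h2, sub_eq_add_neg, h5, Pi.smul_apply]

theorem norm_affineComp (a : ℝ) (ha : a ≠ 0) (b : ℝ) (f : L2R) :
    ‖affineComp a ha b f‖ = (ENNReal.ofReal |a⁻¹| ^ (1 / (2 : ENNReal)).toReal).toReal * ‖f‖ := by
  have h1 : eLpNorm (fun x : ℝ => f (x - b)) 2 volume = eLpNorm f 2 volume :=
    eLpNorm_comp_measurePreserving (Lp.aestronglyMeasurable f)
      (measurePreserving_sub_right volume b)
  have h2 : AEStronglyMeasurable (fun x : ℝ => f (x - b)) volume :=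
    (Lp.aestronglyMeasurable f).comp_measurePreserving (measurePreserving_sub_right volume b)
  have h3 : Measure.map (fun x : ℝ => a * x) volume = ENNReal.ofReal |a⁻¹| • volume :=
    Real.map_volume_mul_left ha
  have h4 := eLpNorm_map_measure (p := 2) (f := fun x : ℝ => a * x) (μ := volume)
    (g := fun x : ℝ => f (x - b))
    (by rw [h3]; exact h2.smul_measure _) (measurable_const_mul a).aemeasurable
  rw [h3, eLpNorm_smul_measure_of_ne_top (by simp), h1] at h4
  rw [Lp.norm_def, eLpNorm_congr_ae (coeFn_affineComp a ha b f), Lp.norm_def]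
  change (eLpNorm ((fun x : ℝ => f (x - b)) ∘ fun x : ℝ => a * x) 2 volume).toReal = _
  rw [← h4, smul_eq_mul, ENNReal.toReal_mul]

theorem continuous_affineComp (a : ℝ) (ha : a ≠ 0) (b : ℝ) :
    Continuous (affineComp a ha b) :=
  (LinearMap.mkContinuous (affineCompLM a ha b) _ fun f => (norm_affineComp a ha b f).le).continuous

/-- Pointwise almost everywhere linear relations between `L²` functions are closed conditions. -/
theorem isClosed_setOf_ae_mul_eq {X : Type*} [TopologicalSpace X] [SequentialSpace X]
    {T₁ T₂ : X → L2R} (h₁ : Continuous T₁) (h₂ : Continuous T₂) (u v : ℝ → ℂ) :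
    IsClosed {x : X | ∀ᵐ ξ, u ξ * T₁ x ξ = v ξ * T₂ x ξ} := by
  refine IsSeqClosed.isClosed fun x y hx hxy => ?_
  obtain ⟨n, hn, h1⟩ := (tendstoInMeasure_of_tendsto_Lp
    ((h₁.tendsto y).comp hxy)).exists_seq_tendsto_ae
  obtain ⟨m, hm, h2⟩ := (tendstoInMeasure_of_tendsto_Lp
    ((h₂.tendsto y).comp (hxy.comp hn.tendsto_atTop))).exists_seq_tendsto_ae
  have h3 : ∀ᵐ ξ, ∀ i, u ξ * T₁ (x i) ξ = v ξ * T₂ (x i) ξ := ae_all_iff.2 hx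
  filter_upwards [h1, h2, h3] with ξ k1 k2 k3
  refine tendsto_nhds_unique ((k1.comp hm.tendsto_atTop).const_mul (u ξ)) ?_
  refine (k2.const_mul (v ξ)).congr fun i => ?_
  exact (k3 _).symm

/-! ### Fourier transforms of affine substitutions -/

/-- The composition of a Schwartz function with `x ↦ a x - b`. -/
def schwartzAffine (a : ℝ) (ha : a ≠ 0) (b : ℝ) (s : SchwartzMap ℝ ℂ) : SchwartzMap ℝ ℂ :=
  SchwartzMap.compCLMOfContinuousLinearEquiv ℂ
    (ContinuousLinearEquiv.unitsEquivAut ℝ (Units.mk0 a ha)) (s.compSubConstCLM ℂ b)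

theorem schwartzAffine_apply (a : ℝ) (ha : a ≠ 0) (b : ℝ) (s : SchwartzMap ℝ ℂ) (x : ℝ) :
    schwartzAffine a ha b s x = s (a * x - b) := by
  simp [schwartzAffine, mul_comm]

theorem affineComp_toLp (a : ℝ) (ha : a ≠ 0) (b : ℝ) (s : SchwartzMap ℝ ℂ) :
    affineComp a ha b (s.toLp 2) = (schwartzAffine a ha b s).toLp 2 := by
  refine Lp.ext ?_
  filter_upwards [coeFn_affineComp a ha b (s.toLp 2), (schwartzAffine a ha b s).coeFn_toLp 2,
    ae_comp_affine (P := fun y => s.toLp 2 volume y = s y) (s.coeFn_toLp 2 volume)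
      ha (-b)] with x h1 h2 h3
  rw [h1, h2, schwartzAffine_apply, sub_eq_add_neg, h3]

theorem fourier_schwartzAffine (a : ℝ) (ha : a ≠ 0) (b : ℝ) (s : SchwartzMap ℝ ℂ) (ξ : ℝ) :
    𝓕 (schwartzAffine a ha b s) ξ =
      (|a⁻¹| : ℝ) * ((𝐞 (-(b * (a⁻¹ * ξ))) : Circle) : ℂ) * 𝓕 s (a⁻¹ * ξ) := by
  have h1 : 𝓕 (schwartzAffine a ha b s) ξ = ∫ x : ℝ, ((𝐞 (-(x * ξ)) : Circle) : ℂ) * s (a * x - b) := by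
    rw [SchwartzMap.fourier_coe, Real.fourier_real_eq]
    simp only [schwartzAffine_apply, Circle.smul_def, smul_eq_mul]
  have h2 : 𝓕 s (a⁻¹ * ξ) = ∫ y : ℝ, ((𝐞 (-(y * (a⁻¹ * ξ))) : Circle) : ℂ) * s y := by
    rw [SchwartzMap.fourier_coe, Real.fourier_real_eq]
    simp only [Circle.smul_def, smul_eq_mul]
  have h3 := Measure.integral_comp_mul_left
    (fun x : ℝ => ((𝐞 (-(x * (a⁻¹ * ξ))) : Circle) : ℂ) * s (x - b)) a
  have h4 := integral_sub_right_eq_self (μ := (volume : Measure ℝ))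
    (fun y : ℝ => ((𝐞 (-((y + b) * (a⁻¹ * ξ))) : Circle) : ℂ) * s y) b
  rw [h1, h2]
  simp only [sub_add_cancel] at h4
  rw [h4] at h3
  have h5 : ∀ x : ℝ, a * x * (a⁻¹ * ξ) = x * ξ := fun x => by field_simp
  simp only [h5] at h3
  rw [h3, mul_assoc, ← integral_const_mul, Complex.real_smul]
  congr 1
  refine integral_congr_ae (Eventually.of_forall fun y => ?_)
  have h6 : -((y + b) * (a⁻¹ * ξ)) = -(b * (a⁻¹ * ξ)) + -(y * (a⁻¹ * ξ)) := by ring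
  have h7 : ((𝐞 (-((y + b) * (a⁻¹ * ξ))) : Circle) : ℂ) =
      (𝐞 (-(b * (a⁻¹ * ξ))) : Circle) * (𝐞 (-(y * (a⁻¹ * ξ))) : Circle) := by
    rw [h6, AddChar.map_add_eq_mul, Circle.coe_mul]
  beta_reduce
  rw [h7, mul_assoc]

theorem denseRange_schwartz_toLp :
    DenseRange (fun s : SchwartzMap ℝ ℂ => (s.toLp 2 volume : L2R)) :=
  SchwartzMap.denseRange_toLpCLM (F := ℂ) (μ := (volume : Measure ℝ)) ENNReal.ofNat_ne_top

theorem continuous_fourier_L2R : Continuous (fun f : L2R => (𝓕 f : L2R)) :=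
  (Lp.fourierTransformₗᵢ ℝ ℂ).continuous

/-- The factor `1` puts the identity in the shape of `isClosed_setOf_ae_mul_eq`, so that it passes
from Schwartz functions to `L²` by density. -/
theorem fourier_affineComp_toLp (a : ℝ) (ha : a ≠ 0) (b : ℝ) (s : SchwartzMap ℝ ℂ) :
    ∀ᵐ ξ : ℝ, 1 * (𝓕 (affineComp a ha b (s.toLp 2 volume)) : L2R) ξ =
      ((|a⁻¹| : ℝ) * ((𝐞 (-(b * (a⁻¹ * ξ))) : Circle) : ℂ)) *
        (affineComp a⁻¹ (inv_ne_zero ha) 0 (𝓕 (s.toLp 2 volume) : L2R)) ξ := by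
  rw [affineComp_toLp, SchwartzMap.toLp_fourier_eq, SchwartzMap.toLp_fourier_eq, affineComp_toLp]
  filter_upwards [(𝓕 (schwartzAffine a ha b s)).coeFn_toLp 2 volume,
    (schwartzAffine a⁻¹ (inv_ne_zero ha) 0 (𝓕 s)).coeFn_toLp 2 volume] with ξ h1 h2
  rw [h1, h2, schwartzAffine_apply, fourier_schwartzAffine, one_mul, sub_zero]

theorem fourier_affineComp (a : ℝ) (ha : a ≠ 0) (b : ℝ) (f : L2R) :
    ∀ᵐ ξ : ℝ, (𝓕 (affineComp a ha b f) : L2R) ξ =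
      (|a⁻¹| : ℝ) * ((𝐞 (-(b * (a⁻¹ * ξ))) : Circle) : ℂ) * (𝓕 f : L2R) (a⁻¹ * ξ) := by
  have hcl := isClosed_setOf_ae_mul_eq
    (continuous_fourier_L2R.comp (continuous_affineComp a ha b))
    ((continuous_affineComp a⁻¹ (inv_ne_zero ha) 0).comp continuous_fourier_L2R) (fun _ => 1)
    (fun ξ => (|a⁻¹| : ℝ) * ((𝐞 (-(b * (a⁻¹ * ξ))) : Circle) : ℂ))
  have key := hcl.closure_subset_iff.2
    (Set.range_subset_iff.2 (fourier_affineComp_toLp a ha b)) (denseRange_schwartz_toLp f)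
  filter_upwards [key, coeFn_affineComp a⁻¹ (inv_ne_zero ha) 0 (𝓕 f : L2R)] with ξ h1 h2
  rw [one_mul, Function.comp_apply, Function.comp_apply, h2, sub_zero] at h1
  exact h1

theorem fourier_translate (b : ℝ) (f : L2R) :
    ∀ᵐ ξ : ℝ, (𝓕 (translate b f) : L2R) ξ = ((𝐞 (-(b * ξ)) : Circle) : ℂ) * (𝓕 f : L2R) ξ := by
  filter_upwards [fourier_affineComp 1 one_ne_zero b f] with ξ h
  simpa [translate] using h

theorem fourier_dilateTwo (f : L2R) :
    ∀ᵐ ξ : ℝ, (𝓕 (dilateTwo f) : L2R) (2 * ξ) = 2⁻¹ * (𝓕 f : L2R) ξ := by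
  filter_upwards [ae_comp_affine (fourier_affineComp 2 two_ne_zero 0 f) two_ne_zero 0] with ξ h
  simpa [dilateTwo] using h

theorem dilateTwo_surjective : Function.Surjective dilateTwo := by
  intro f
  refine ⟨affineComp 2⁻¹ (by norm_num) 0 f, Lp.ext ?_⟩
  filter_upwards [coeFn_affineComp 2 two_ne_zero 0 (affineComp 2⁻¹ (by norm_num) 0 f),
    ae_comp_affine (coeFn_affineComp 2⁻¹ (by norm_num) 0 f) two_ne_zero (-0)] with x h1 h2
  rw [dilateTwo, h1, sub_eq_add_neg, h2]
  congr 1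
  ring

/-! ### Periodization over the integers -/

/-- The identification of `ℤ` with the subgroup of integers in `ℝ`. -/
def intEquivZMultiples : ℤ ≃ AddSubgroup.zmultiples (1 : ℝ) :=
  Equiv.ofBijective
    (codRestrict (fun n : ℤ => n • (1 : ℝ)) (AddSubgroup.zmultiples (1 : ℝ)) fun n => ⟨n, rfl⟩)
    (Equiv.ofInjective (fun n : ℤ => n • (1 : ℝ))
      (zsmul_left_strictMono one_pos).injective).bijective

theorem intEquivZMultiples_vadd (n : ℤ) (x : ℝ) : intEquivZMultiples n +ᵥ x = x + n := by
  change n • (1 : ℝ) + x = x + n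
  simp [add_comm]

theorem lintegral_eq_tsum_Ioc (f : ℝ → ENNReal) :
    ∫⁻ x, f x = ∑' n : ℤ, ∫⁻ x in Ioc (0 : ℝ) 1, f (x + n) := by
  have h := (isAddFundamentalDomain_Ioc one_pos 0 volume).lintegral_eq_tsum'' f
  rw [h, ← intEquivZMultiples.tsum_eq, zero_add]
  simp only [intEquivZMultiples_vadd]

theorem integral_eq_tsum_Ioc {f : ℝ → ℂ} (hf : Integrable f) :
    ∫ x, f x = ∑' n : ℤ, ∫ x in Ioc (0 : ℝ) 1, f (x + n) := by
  have h := (isAddFundamentalDomain_Ioc one_pos 0 volume).integral_eq_tsum'' f hf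
  rw [h, ← intEquivZMultiples.tsum_eq, zero_add]
  simp only [intEquivZMultiples_vadd]

theorem integral_eq_setIntegral_periodization {f : ℝ → ℂ} (hf : Integrable f) :
    ∫ x, f x = ∫ x in Ioc (0 : ℝ) 1, ∑' n : ℤ, f (x + n) := by
  rw [integral_eq_tsum_Ioc hf, integral_tsum]
  · exact fun n => (hf.comp_add_right (n : ℝ)).aestronglyMeasurable.restrict
  · rw [← lintegral_eq_tsum_Ioc (fun x => ‖f x‖ₑ)]
    exact hf.2.ne

theorem ae_of_ae_Ioc {P : ℝ → Prop} (hP : ∀ (x : ℝ) (n : ℤ), P (x + n) → P x)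
    (h : ∀ᵐ x, x ∈ Ioc (0 : ℝ) 1 → P x) : ∀ᵐ x, P x := by
  have h1 : ∀ᵐ x : ℝ, ∀ n : ℤ, x + n ∈ Ioc (0 : ℝ) 1 → P (x + n) :=
    ae_all_iff.2 fun n => (measurePreserving_add_right volume (n : ℝ)).quasiMeasurePreserving.ae h
  filter_upwards [h1] with x hx
  -- The ceiling, not the floor, fits an interval open at `0` and closed at `1`.
  refine hP x (-(⌈x⌉ - 1)) (hx _ ?_)
  push_cast
  constructor
  · linarith [Int.ceil_lt_add_one x]
  · linarith [Int.le_ceil x]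

theorem summable_norm_shift_iff (f : ℝ → ℂ) (x : ℝ) (n : ℤ) :
    (Summable fun k : ℤ => ‖f (x + n + k)‖) ↔ Summable fun k : ℤ => ‖f (x + k)‖ := by
  rw [← (Equiv.addLeft n).summable_iff (f := fun k : ℤ => ‖f (x + k)‖)]
  refine summable_congr fun k => ?_
  simp [add_assoc]

theorem tsum_shift (f : ℝ → ℂ) (x : ℝ) (n : ℤ) :
    ∑' k : ℤ, f (x + n + k) = ∑' k : ℤ, f (x + k) := by
  rw [← (Equiv.addLeft n).tsum_eq (fun k : ℤ => f (x + k))]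
  refine tsum_congr fun k => ?_
  simp [add_assoc]

theorem ae_summable_periodization {f : ℝ → ℂ} (hf : Integrable f) :
    ∀ᵐ x : ℝ, Summable fun k : ℤ => ‖f (x + k)‖ := by
  refine ae_of_ae_Ioc (fun x n => (summable_norm_shift_iff f x n).1) ?_
  have h1 : ∫⁻ x in Ioc (0 : ℝ) 1, ∑' n : ℤ, ‖f (x + n)‖ₑ ≠ ⊤ := by
    rw [lintegral_tsum, ← lintegral_eq_tsum_Ioc (fun x => ‖f x‖ₑ)]
    · exact hf.2.ne
    · exact fun n => (hf.comp_add_right (n : ℝ)).aestronglyMeasurable.restrict.enorm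
  have h2 := ae_lt_top' (AEMeasurable.tsum fun n : ℤ =>
    (hf.comp_add_right (n : ℝ)).aestronglyMeasurable.restrict.enorm) h1
  filter_upwards [(ae_restrict_iff' measurableSet_Ioc).1 h2] with x hx hx1
  have h3 := (hx hx1).ne
  simp only [enorm_eq_nnnorm] at h3
  have h4 := ENNReal.tsum_coe_ne_top_iff_summable.1 h3
  exact NNReal.summable_coe.2 h4

theorem integrable_mul_continuousMap {f : ℝ → ℂ} (hf : Integrable f)
    (q : C(AddCircle (1 : ℝ), ℂ)) : Integrable fun x : ℝ => f x * q x := by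
  refine hf.mul_bdd (c := ‖q‖) ?_ (Eventually.of_forall fun x => q.norm_coe_le_norm _)
  exact (q.continuous.comp (AddCircle.continuous_mk' 1)).aestronglyMeasurable

/-- Integration of an integrable function on the line against continuous periodic functions. -/
def periodicPairing {f : ℝ → ℂ} (hf : Integrable f) : C(AddCircle (1 : ℝ), ℂ) →ₗ[ℂ] ℂ where
  toFun q := ∫ x : ℝ, f x * q x
  map_add' q r := by
    simp only [ContinuousMap.add_apply, mul_add]
    exact integral_add (integrable_mul_continuousMap hf q) (integrable_mul_continuousMap hf r)
  map_smul' c q := by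
    simp only [ContinuousMap.smul_apply, smul_eq_mul, RingHom.id_apply, mul_left_comm _ c]
    exact integral_const_mul _ _

theorem continuous_periodicPairing {f : ℝ → ℂ} (hf : Integrable f) :
    Continuous (periodicPairing hf) := by
  refine AddMonoidHomClass.continuous_of_bound (periodicPairing hf) (∫ x, ‖f x‖) fun q => ?_
  change ‖∫ x : ℝ, f x * q x‖ ≤ _
  rw [← integral_mul_const]
  refine norm_integral_le_of_norm_le (hf.norm.mul_const _) (Eventually.of_forall fun x => ?_)
  rw [norm_mul]
  exact mul_le_mul_of_nonneg_left (q.norm_coe_le_norm _) (norm_nonneg _)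

/-- Trigonometric polynomials are uniformly dense on the circle, and the pairing is bounded by the
`L¹` norm of `f`. -/
theorem periodicPairing_eq_zero {f : ℝ → ℂ} (hf : Integrable f)
    (h : ∀ n : ℤ, ∫ x : ℝ, f x * fourier n (x : AddCircle (1 : ℝ)) = 0)
    (q : C(AddCircle (1 : ℝ), ℂ)) : ∫ x : ℝ, f x * q x = 0 := by
  have : Fact ((0 : ℝ) < 1) := ⟨one_pos⟩
  have h1 : Submodule.span ℂ (range (@fourier 1)) ≤ LinearMap.ker (periodicPairing hf) := by
    rw [Submodule.span_le]
    rintro _ ⟨n, rfl⟩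
    exact h n
  have h2 : IsClosed (LinearMap.ker (periodicPairing hf) : Set C(AddCircle (1 : ℝ), ℂ)) :=
    isClosed_singleton.preimage (continuous_periodicPairing hf)
  have h3 := Submodule.topologicalClosure_minimal _ h1 h2
  rw [span_fourier_closure_eq_top] at h3
  exact h3 (Submodule.mem_top (x := q))

/-- An integrable function whose Fourier transform vanishes at the integers has vanishing
periodization. -/
theorem periodization_eq_zero {f : ℝ → ℂ} (hf : Integrable f)
    (h : ∀ n : ℤ, ∫ x : ℝ, f x * fourier n (x : AddCircle (1 : ℝ)) = 0) :
    ∀ᵐ x : ℝ, ∑' k : ℤ, f (x + k) = 0 := by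
  have : Fact ((0 : ℝ) < 1) := ⟨one_pos⟩
  refine ae_of_ae_Ioc (fun x n hx => by rwa [tsum_shift] at hx) ?_
  have hint : IntegrableOn (fun x : ℝ => ∑' k : ℤ, f (x + k)) (Ioc 0 1) := by
    have hm : ∀ k : ℤ, AEMeasurable (fun x : ℝ => f (x + k)) (volume.restrict (Ioc 0 1)) :=
      fun k => (hf.comp_add_right (k : ℝ)).aestronglyMeasurable.restrict.aemeasurable
    refine ⟨(AEMeasurable.tsum hm).aestronglyMeasurable, ?_⟩
    refine lt_of_le_of_lt (lintegral_mono fun x => enorm_tsum_le_tsum_enorm) ?_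
    rw [lintegral_tsum fun k => (hm k).enorm, ← lintegral_eq_tsum_Ioc (fun x => ‖f x‖ₑ)]
    exact hf.2
  have h1 : ∀ᵐ x : ℝ, x ∈ Ioo (0 : ℝ) 1 → ∑' k : ℤ, f (x + k) = 0 := by
    refine isOpen_Ioo.ae_eq_zero_of_integral_contDiff_smul_eq_zero
      (hint.mono_set Ioo_subset_Ioc_self).locallyIntegrableOn fun g hg _ hgs => ?_
    have hg0 : g 0 = 0 := image_eq_zero_of_notMem_tsupport fun h0 => (hgs h0).1.false
    have hg1 : g 1 = 0 := image_eq_zero_of_notMem_tsupport fun h0 => (hgs h0).2.false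
    -- A test function supported in the open unit interval vanishes at both ends, so its periodic
    -- extension is continuous.
    let q : C(AddCircle (1 : ℝ), ℂ) := ⟨AddCircle.liftIoc 1 0 fun x => (g x : ℂ),
      AddCircle.liftIoc_continuous (by simp [hg0, hg1])
        (Complex.continuous_ofReal.comp hg.continuous).continuousOn⟩
    have h2 := periodicPairing_eq_zero hf h q
    rw [integral_eq_setIntegral_periodization (integrable_mul_continuousMap hf q)] at h2
    rw [← h2, ← setIntegral_eq_integral_of_forall_compl_eq_zero (s := Ioc (0 : ℝ) 1)]
    · refine setIntegral_congr_fun measurableSet_Ioc fun x hx => ?_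
      have h3 : ∀ k : ℤ, q ((x + k : ℝ) : AddCircle (1 : ℝ)) = g x := fun k => by
        have h4 : ((x + k : ℝ) : AddCircle (1 : ℝ)) = (x : AddCircle (1 : ℝ)) := by
          have h5 := (AddCircle.coe_eq_zero_iff (1 : ℝ) (x := (k : ℝ))).2 ⟨k, by simp⟩
          rw [AddCircle.coe_add, h5, add_zero]
        rw [h4]
        exact AddCircle.liftIoc_zero_coe_apply (f := fun x => (g x : ℂ)) hx
      simp only [h3]
      rw [tsum_mul_right, Complex.real_smul, mul_comm]
    · intro x hx
      rw [image_eq_zero_of_notMem_tsupport fun h0 => hx (Ioo_subset_Ioc_self (hgs h0)), zero_smul]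
  have h2 : ∀ᵐ x : ℝ, x ≠ 1 := by simp [ae_iff]
  filter_upwards [h1, h2] with x hx hx1 hx2
  exact hx ⟨hx2.1, lt_of_le_of_ne hx2.2 hx1⟩

/-- An integrable function whose Fourier transform at the integers is `c` at `0` and zero
elsewhere has constant periodization `c`. -/
theorem periodization_eq_const {f : ℝ → ℂ} (hf : Integrable f) (c : ℂ)
    (h : ∀ n : ℤ, ∫ x : ℝ, f x * fourier n (x : AddCircle (1 : ℝ)) = if n = 0 then c else 0) :
    ∀ᵐ x : ℝ, ∑' k : ℤ, f (x + k) = c := by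
  have : Fact ((0 : ℝ) < 1) := ⟨one_pos⟩
  -- A model with the prescribed coefficients and constant periodization `c`; the difference `f - e`
  -- falls under `periodization_eq_zero`.
  set e : ℝ → ℂ := (Ioc (0 : ℝ) 1).indicator fun _ => c with he
  have he1 : Integrable e := (integrable_indicator_iff measurableSet_Ioc).2 (by simp)
  have he2 : ∀ n : ℤ, ∫ x : ℝ, e x * fourier n (x : AddCircle (1 : ℝ)) = if n = 0 then c else 0 := by
    intro n
    have h1 : ∀ x : ℝ, e x * fourier n (x : AddCircle (1 : ℝ)) =
        (Ioc (0 : ℝ) 1).indicator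
          (fun x : ℝ => c * Complex.exp (2 * Real.pi * Complex.I * n * x)) x := by
      intro x
      rw [he, fourier_coe_apply, Complex.ofReal_one, div_one]
      by_cases hx : x ∈ Ioc (0 : ℝ) 1 <;> simp [hx]
    simp only [h1]
    rw [integral_indicator measurableSet_Ioc, integral_const_mul,
      ← intervalIntegral.integral_of_le zero_le_one]
    split_ifs with hn
    · simp [hn]
    · have hn' : (2 * Real.pi * Complex.I * n : ℂ) ≠ 0 :=
        mul_ne_zero Complex.two_pi_I_ne_zero (Int.cast_ne_zero.2 hn)
      rw [integral_exp_mul_complex hn']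
      have h2 : Complex.exp (2 * Real.pi * Complex.I * n) = 1 := by
        rw [mul_comm]
        exact Complex.exp_int_mul_two_pi_mul_I n
      simp [h2]
  have he3 : ∀ x : ℝ, HasSum (fun k : ℤ => e (x + k)) c := by
    intro x
    obtain ⟨m, hm, hu⟩ := existsUnique_add_zsmul_mem_Ioc one_pos x 0
    have h1 : e (x + m) = c := by
      rw [he, indicator_of_mem]
      simpa using hm
    rw [← h1]
    refine hasSum_single m fun k hk => ?_
    rw [he, indicator_of_notMem]
    exact fun hk2 => hk (hu k (by simpa using hk2))
  have h1 := periodization_eq_zero (hf.sub he1) fun n => by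
    have h2 := integral_sub (integrable_mul_continuousMap hf (fourier n))
      (integrable_mul_continuousMap he1 (fourier n))
    rw [h n, he2 n, sub_self] at h2
    simpa only [Pi.sub_apply, sub_mul] using h2
  filter_upwards [h1, ae_summable_periodization hf] with x hx hs
  have h2 := (hs.of_norm.hasSum.sub (he3 x)).tsum_eq
  simp only [Pi.sub_apply] at hx
  rw [hx] at h2
  exact sub_eq_zero.1 h2.symm

/-! ### Bracket products and orthogonality of translates -/

theorem inner_translate_eq_integral (f h : L2R) (n : ℤ) :
    inner ℂ (translate (n : ℝ) f) h =
      ∫ ξ : ℝ, (conj ((𝓕 f : L2R) ξ) * (𝓕 h : L2R) ξ) * fourier n (ξ : AddCircle (1 : ℝ)) := by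
  rw [← Lp.inner_fourier_eq, L2.inner_def]
  refine integral_congr_ae ?_
  filter_upwards [fourier_translate (n : ℝ) f] with ξ h1
  have h2 : conj (((𝐞 (-(n * ξ)) : Circle) : ℂ)) = fourier n (ξ : AddCircle (1 : ℝ)) := by
    rw [← Circle.coe_inv_eq_conj, ← AddChar.map_neg_eq_inv, neg_neg, Real.fourierChar_apply,
      fourier_coe_apply]
    congr 1
    push_cast
    ring
  rw [h1, RCLike.inner_apply, map_mul, h2]
  ring

theorem integrable_conj_mul (f h : L2R) : Integrable fun ξ : ℝ => conj (f ξ) * h ξ := by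
  refine (L2.integrable_inner (𝕜 := ℂ) f h).congr (Eventually.of_forall fun ξ => ?_)
  simp [RCLike.inner_apply, mul_comm]

/-- The bracket product `∑ₖ conj f̂(ξ + k) ĥ(ξ + k)` is constant when `h` is orthogonal to all
nontrivial integer translates of `f`. -/
theorem bracket_eq_const (f h : L2R) (c : ℂ)
    (H : ∀ n : ℤ, inner ℂ (translate (n : ℝ) f) h = if n = 0 then c else 0) :
    ∀ᵐ ξ : ℝ, ∑' k : ℤ, conj ((𝓕 f : L2R) (ξ + k)) * (𝓕 h : L2R) (ξ + k) = c :=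
  periodization_eq_const (integrable_conj_mul (𝓕 f : L2R) (𝓕 h : L2R)) c fun n => by
    rw [← inner_translate_eq_integral, H n]

theorem translate_zero (f : L2R) : translate 0 f = f := by
  refine Lp.ext ?_
  filter_upwards [coeFn_affineComp 1 one_ne_zero 0 f] with x h
  rw [translate, h, one_mul, sub_zero]

theorem bracket_self_eq_one (f : L2R) (hf : Orthonormal ℂ fun k : ℤ => translate (k : ℝ) f) :
    ∀ᵐ ξ : ℝ, ∑' k : ℤ, conj ((𝓕 f : L2R) (ξ + k)) * (𝓕 f : L2R) (ξ + k) = 1 := by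
  refine bracket_eq_const f f 1 fun n => ?_
  have h := orthonormal_iff_ite.1 hf n 0
  simp only [Int.cast_zero, translate_zero] at h
  exact h

/-! ### Two-scale relations and density of the MRA -/

/-- The `L²` functions whose Fourier transform is, on each coset of `ℤ`, proportional to that of
`φ`. -/
def periodicMultiples (φ : L2R) : Submodule ℂ L2R where
  carrier := {f | ∀ k : ℤ, ∀ᵐ ξ : ℝ,
    (𝓕 φ : L2R) (ξ + k) * (𝓕 f : L2R) ξ = (𝓕 φ : L2R) ξ * (𝓕 f : L2R) (ξ + k)}
  add_mem' {f h} hf hh k := by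
    have h0 : (𝓕 (f + h) : L2R) = 𝓕 f + 𝓕 h := (Lp.fourierTransformₗᵢ ℝ ℂ).map_add f h
    have h1 := Lp.coeFn_add (𝓕 f : L2R) (𝓕 h : L2R)
    have h2 := ae_comp_affine h1 one_ne_zero (k : ℝ)
    filter_upwards [hf k, hh k, h1, h2] with ξ k1 k2 k3 k4
    rw [one_mul] at k4
    rw [h0, k3, k4, Pi.add_apply, Pi.add_apply, mul_add, mul_add, k1, k2]
  zero_mem' k := by
    have h0 : (𝓕 (0 : L2R) : L2R) = 0 := (Lp.fourierTransformₗᵢ ℝ ℂ).map_zero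
    have h1 := Lp.coeFn_zero ℂ 2 (volume : Measure ℝ)
    have h2 := ae_comp_affine h1 one_ne_zero (k : ℝ)
    filter_upwards [h1, h2] with ξ k3 k4
    rw [one_mul] at k4
    rw [h0, k3, k4, Pi.zero_apply, Pi.zero_apply, mul_zero, mul_zero]
  smul_mem' c f hf k := by
    have h0 : (𝓕 (c • f) : L2R) = c • 𝓕 f := (Lp.fourierTransformₗᵢ ℝ ℂ).map_smul c f
    have h1 := Lp.coeFn_smul c (𝓕 f : L2R)
    have h2 := ae_comp_affine h1 one_ne_zero (k : ℝ)
    filter_upwards [hf k, h1, h2] with ξ k1 k3 k4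
    rw [one_mul] at k4
    rw [h0, k3, k4, Pi.smul_apply, Pi.smul_apply, smul_eq_mul, smul_eq_mul, mul_left_comm, k1,
      mul_left_comm]

theorem isClosed_periodicMultiples (φ : L2R) : IsClosed (periodicMultiples φ : Set L2R) := by
  have h1 : (periodicMultiples φ : Set L2R) = ⋂ k : ℤ, {f : L2R | ∀ᵐ ξ : ℝ,
      (𝓕 φ : L2R) (ξ + k) * (𝓕 f : L2R) ξ =
        (𝓕 φ : L2R) ξ * (affineComp 1 one_ne_zero (-(k : ℝ)) (𝓕 f : L2R)) ξ} := by
    ext f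
    rw [mem_iInter]
    refine forall_congr' fun k => eventually_congr ?_
    filter_upwards [coeFn_affineComp 1 one_ne_zero (-(k : ℝ)) (𝓕 f : L2R)] with ξ h
    rw [h, one_mul, sub_neg_eq_add]
  rw [h1]
  exact isClosed_iInter fun k => isClosed_setOf_ae_mul_eq continuous_fourier_L2R
    ((continuous_affineComp 1 one_ne_zero (-(k : ℝ))).comp continuous_fourier_L2R) _ _

theorem translate_mem_periodicMultiples (φ : L2R) (n : ℤ) :
    translate (n : ℝ) φ ∈ periodicMultiples φ := by
  intro k
  have h1 := fourier_translate (n : ℝ) φ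
  filter_upwards [h1, ae_comp_affine h1 one_ne_zero (k : ℝ)] with ξ k1 k2
  rw [one_mul] at k2
  have h3 : -((n : ℝ) * (ξ + k)) = -(n * ξ) + ((-(n * k) : ℤ) : ℝ) := by push_cast; ring
  have h4 : ((𝐞 (((-(n * k) : ℤ) : ℝ)) : Circle) : ℂ) = 1 := by
    rw [Real.fourierChar_apply]
    have := Complex.exp_int_mul_two_pi_mul_I (-(n * k))
    rw [← this]
    congr 1
    push_cast
    ring
  rw [k1, k2, h3, AddChar.map_add_eq_mul, Circle.coe_mul, h4]
  ring

theorem closure_span_translates_le (φ : L2R) :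
    (Submodule.span ℂ (range fun k : ℤ => translate (k : ℝ) φ)).topologicalClosure ≤
      periodicMultiples φ := by
  refine Submodule.topologicalClosure_minimal _ ?_ (isClosed_periodicMultiples φ)
  rw [Submodule.span_le]
  rintro _ ⟨n, rfl⟩
  exact translate_mem_periodicMultiples φ n

/-- The two-scale relation, in the form that `f̂(2 ·)` is proportional to `φ̂` on cosets of `ℤ`. -/
theorem two_scale_relation {φ f : L2R} (hf : f ∈ periodicMultiples φ) (k : ℤ) :
    ∀ᵐ ξ : ℝ, (𝓕 φ : L2R) (ξ + k) * (𝓕 (dilateTwo f) : L2R) (2 * ξ) =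
      (𝓕 φ : L2R) ξ * (𝓕 (dilateTwo f) : L2R) (2 * ξ + (2 * k : ℤ)) := by
  have h1 := fourier_dilateTwo f
  filter_upwards [hf k, h1, ae_comp_affine h1 one_ne_zero (k : ℝ)] with ξ k1 k2 k3
  have h2 : 2 * ξ + ((2 * k : ℤ) : ℝ) = 2 * (1 * ξ + k) := by push_cast; ring
  rw [h2, k2, k3, one_mul, mul_left_comm, k1, mul_left_comm]

/-- For `n = 0`, a zero of `φ̂` has some shift that is not a zero, and the proportionality relation
between the two points kills `f̂`. Dilation carries this up the scale. -/
theorem fourier_eq_zero_of_mem {V : ℤ → Submodule ℂ L2R} (hV : IsMRA V) {φ : L2R}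
    (h0 : V 0 ≤ periodicMultiples φ)
    (hφ : ∀ᵐ ξ : ℝ, ∃ k : ℤ, (𝓕 φ : L2R) (ξ + k) ≠ 0) (n : ℕ) :
    ∀ f ∈ V n, ∀ᵐ ξ : ℝ, (𝓕 φ : L2R) (((2 : ℝ) ^ n)⁻¹ * ξ) = 0 → (𝓕 f : L2R) ξ = 0 := by
  induction n with
  | zero =>
    intro f hf
    have h1 : ∀ᵐ ξ : ℝ, ∀ k : ℤ,
      (𝓕 φ : L2R) (ξ + k) * (𝓕 f : L2R) ξ = (𝓕 φ : L2R) ξ * (𝓕 f : L2R) (ξ + k) :=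
      ae_all_iff.2 (h0 hf)
    filter_upwards [h1, hφ] with ξ k1 k2 k3
    obtain ⟨k, hk⟩ := k2
    rw [pow_zero, inv_one, one_mul] at k3
    have h2 := k1 k
    rw [k3, zero_mul] at h2
    exact (mul_eq_zero.1 h2).resolve_left hk
  | succ n ih =>
    intro f hf
    obtain ⟨e, rfl⟩ := dilateTwo_surjective f
    have he : e ∈ V n := (hV.mem_iff_dilate_mem n e).2 (by exact_mod_cast hf)
    have h1 := fourier_dilateTwo e
    filter_upwards [ae_comp_affine (ih e he) (inv_ne_zero (two_ne_zero (α := ℝ))) 0,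
      ae_comp_affine h1 (inv_ne_zero (two_ne_zero (α := ℝ))) 0] with ξ k1 k2 k3
    rw [add_zero] at k1 k2
    rw [mul_inv_cancel_left₀ two_ne_zero] at k2
    rw [k2, k1, mul_zero]
    rw [← k3, pow_succ, mul_inv, mul_assoc]

/-- By density of the union of the `V j`, the dilates of `φ̂` have no common zeros. -/
theorem exists_fourier_ne_zero {V : ℤ → Submodule ℂ L2R} (hV : IsMRA V) {φ : L2R}
    (h0 : V 0 ≤ periodicMultiples φ)
    (hφ : ∀ᵐ ξ : ℝ, ∃ k : ℤ, (𝓕 φ : L2R) (ξ + k) ≠ 0) :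
    ∀ᵐ ξ : ℝ, ∃ n : ℕ, (𝓕 φ : L2R) (((2 : ℝ) ^ n)⁻¹ * ξ) ≠ 0 := by
  set Z : Set ℝ := {ξ | ∀ n : ℕ, (𝓕 φ : L2R) (((2 : ℝ) ^ n)⁻¹ * ξ) = 0} with hZ
  have hm : Measurable (𝓕 φ : L2R) := (Lp.stronglyMeasurable _).measurable
  have hZm : MeasurableSet Z := by
    rw [hZ, ofPred_forall]
    exact MeasurableSet.iInter fun n =>
      (hm.comp (measurable_const_mul _)) (measurableSet_singleton 0)
  -- Vanishing of `f̂` on the common zero set `Z` is a closed condition; once it holds for all `f`,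
  -- taking `f̂` to be the indicator of `[-N, N]` shows that `Z` is null.
  have hcl := isClosed_setOf_ae_mul_eq continuous_fourier_L2R continuous_fourier_L2R
    (Z.indicator fun _ => 1) (fun _ => 0)
  have hmono : ∀ n : ℕ, V (-(n : ℤ)) ≤ V 0 := by
    intro n
    induction n with
    | zero => simp
    | succ n ih =>
      have := hV.mono (-((n : ℤ) + 1))
      rw [neg_add, neg_add_cancel_right] at this
      push_cast
      rw [neg_add]
      exact this.trans ih
  have hmem : ∀ n : ℕ, ∀ f ∈ V n,
      ∀ᵐ ξ : ℝ, Z.indicator (fun _ => (1 : ℂ)) ξ * (𝓕 f : L2R) ξ = 0 * (𝓕 f : L2R) ξ := by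
    intro n f hf
    filter_upwards [fourier_eq_zero_of_mem hV h0 hφ n f hf] with ξ k1
    by_cases hξ : ξ ∈ Z
    · rw [k1 (hξ n), mul_zero, mul_zero]
    · rw [indicator_of_notMem hξ]
  have hall : ∀ f : L2R,
      ∀ᵐ ξ : ℝ, Z.indicator (fun _ => (1 : ℂ)) ξ * (𝓕 f : L2R) ξ = 0 * (𝓕 f : L2R) ξ := by
    intro f
    refine hcl.closure_subset_iff.2 (iUnion_subset fun j => ?_)
      (hV.dense_iUnion ▸ mem_univ f : f ∈ closure (⋃ j, (V j : Set L2R)))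
    intro e he
    obtain ⟨n, rfl | rfl⟩ := j.eq_nat_or_neg
    · exact hmem n e he
    · exact hmem 0 e (hmono n he)
  have hN : ∀ N : ℕ, ∀ᵐ ξ : ℝ, ξ ∈ Z → ξ ∉ Icc (-(N : ℝ)) N := by
    intro N
    have hmeas : MeasurableSet (Icc (-(N : ℝ)) N) := measurableSet_Icc
    set e : L2R := indicatorConstLp 2 hmeas (by simp) (1 : ℂ)
    have h1 := hall (𝓕⁻ e)
    rw [FourierTransform.fourier_fourierInv_eq] at h1
    filter_upwards [h1, indicatorConstLp_coeFn (p := 2) (hs := hmeas) (hμs := by simp) (c := (1 : ℂ))]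
      with ξ k1 k2 hξ hξ2
    rw [indicator_of_mem hξ, k2, indicator_of_mem hξ2] at k1
    simp at k1
  filter_upwards [ae_all_iff.2 hN] with ξ hξ
  by_contra! hc
  obtain ⟨N, hN'⟩ := exists_nat_ge |ξ|
  exact hξ N hc (abs_le.1 hN')

theorem waveletSystem_zero (ψ : L2R) (k : ℤ) : waveletSystem ψ (0, k) = translate (k : ℝ) ψ := by
  simp [waveletSystem, translate]

theorem orthonormal_translates {ψ : L2R} (hψ : IsONWavelet ψ) :
    Orthonormal ℂ fun k : ℤ => translate (k : ℝ) ψ := by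
  have h := hψ.1.comp (fun k : ℤ => ((0 : ℤ), k)) fun k l hkl => (Prod.ext_iff.1 hkl).2
  simpa only [Function.comp_def, waveletSystem_zero] using h

/-! ### Relations at a single frequency -/

/-- The pointwise relations between the Fourier transforms `p` of a scaling function and `h` of an
associated wavelet, at the frequency `x`. -/
structure PointwiseRelations (p h : ℝ → ℂ) (x : ℝ) : Prop where
  scaling : ∀ k : ℤ, p (x + k) * p (2 * x) = p x * p (2 * x + (2 * k : ℤ))
  wavelet : ∀ k : ℤ, p (x + k) * h (2 * x) = p x * h (2 * x + (2 * k : ℤ))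
  exists_ne_zero : ∃ k : ℤ, p (x + k) ≠ 0
  bracket_wavelet : ∑' k : ℤ, conj (h (x + k)) * h (x + k) = 1
  bracket_scaling : ∑' k : ℤ, conj (p (x + k)) * h (x + k) = 0
  exists_dilate_ne_zero : ∃ n : ℕ, p (((2 : ℝ) ^ n)⁻¹ * x) ≠ 0

theorem exists_pointwiseRelations {ψ : L2R} (hψ : IsMRAWavelet ψ) :
    ∃ p : ℝ → ℂ, Measurable p ∧ ∀ᵐ x : ℝ, PointwiseRelations p (𝓕 ψ : L2R) x := by
  obtain ⟨hw, V, hV, h1, h0⟩ := hψ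
  obtain ⟨φ, hφV, hφo, hφs⟩ := hV.exists_scaling
  have hle : V 0 ≤ periodicMultiples φ := hφs ▸ closure_span_translates_le φ
  have htr : ∀ n : ℤ, translate (n : ℝ) φ ∈ V 0 := fun n => by
    rw [← hφs]
    exact Submodule.le_topologicalClosure _ (Submodule.subset_span ⟨n, rfl⟩)
  have hne : ∀ᵐ ξ : ℝ, ∃ k : ℤ, (𝓕 φ : L2R) (ξ + k) ≠ 0 := by
    filter_upwards [bracket_self_eq_one φ hφo] with ξ hξ
    by_contra! hc
    simp [hc] at hξ
  have hsc : ∀ f ∈ V 1, ∀ᵐ ξ : ℝ, ∀ k : ℤ, (𝓕 φ : L2R) (ξ + k) * (𝓕 f : L2R) (2 * ξ) =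
      (𝓕 φ : L2R) ξ * (𝓕 f : L2R) (2 * ξ + (2 * k : ℤ)) := by
    intro f hf
    obtain ⟨e, rfl⟩ := dilateTwo_surjective f
    have he : e ∈ V 0 := (hV.mem_iff_dilate_mem 0 e).2 (by rwa [zero_add])
    exact ae_all_iff.2 (two_scale_relation (hle he))
  have hφ1 : φ ∈ V 1 := by simpa using hV.mono 0 hφV
  refine ⟨(𝓕 φ : L2R), (Lp.stronglyMeasurable _).measurable, ?_⟩
  filter_upwards [hsc φ hφ1, hsc ψ h1, hne, bracket_self_eq_one ψ (orthonormal_translates hw),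
    bracket_eq_const φ ψ 0 fun n => by
      rw [ite_self]
      exact (Submodule.mem_orthogonal _ _).1 h0 _ (htr n),
    exists_fourier_ne_zero hV hle hne] with x a1 a2 a3 a4 a5 a6
  exact ⟨a1, a2, a3, a4, a5, a6⟩

/-- On odd indices `a = c b` for a constant `c`, since `b` is nonzero at some odd index. As `b`
vanishes at even indices, the second sum is `conj c` times the first, so `c = 0`. -/
theorem eq_zero_of_bracket {a b : ℤ → ℂ} (hev : ∀ k, b (2 * k) = 0)
    (hpar : ∀ i j, a (2 * i + 1) * b (2 * j + 1) = a (2 * j + 1) * b (2 * i + 1))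
    (hb : ∑' k, conj (b k) * b k = 1) (hab : ∑' k, conj (a k) * b k = 0) (i : ℤ) :
    a (2 * i + 1) = 0 := by
  obtain ⟨m, hm⟩ : ∃ m, b m ≠ 0 := by
    by_contra! hc
    simp [hc] at hb
  obtain ⟨j, rfl | rfl⟩ := m.even_or_odd'
  · exact absurd (hev j) hm
  have h1 : ∀ i, a (2 * i + 1) = a (2 * j + 1) / b (2 * j + 1) * b (2 * i + 1) := fun i => by
    rw [div_mul_eq_mul_div, eq_div_iff hm, hpar]
  have h2 : ∀ k, conj (a k) * b k = conj (a (2 * j + 1) / b (2 * j + 1)) * (conj (b k) * b k) := by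
    intro k
    obtain ⟨l, rfl | rfl⟩ := k.even_or_odd'
    · rw [hev]
      ring
    · rw [h1 l, map_mul]
      ring
  simp only [h2, tsum_mul_left, hb, mul_one] at hab
  have h3 := (map_eq_zero (starRingEnd ℂ)).1 hab
  rw [h1 i, h3, zero_mul]

/-! ### Partitions modulo null sets and invariant conull sets -/

theorem isPartitionModNull_of_ae_existsUnique {ι : Type*} {P : ι → Set ℝ}
    (h : ∀ᵐ x : ℝ, ∃! i, x ∈ P i) : IsPartitionModNull P := by
  refine ⟨fun i j hij => measure_mono_null (fun x hx => ?_) h,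
    measure_mono_null (fun x hx => ?_) h⟩
  · exact fun hu => hij (hu.unique hx.1 hx.2)
  · exact fun hu => hx (mem_iUnion.2 hu.exists)

/-- A measurable conull set of irrational frequencies, invariant under rational affine maps, at which
the pointwise relations hold. -/
structure IsGoodSet (p h : ℝ → ℂ) (E : Set ℝ) : Prop where
  measurableSet : MeasurableSet E
  ae_mem : ∀ᵐ x : ℝ, x ∈ E
  affine_mem : ∀ x ∈ E, ∀ a b : ℚ, a ≠ 0 → (a * x + b : ℝ) ∈ E
  irrational : ∀ x ∈ E, Irrational x
  relations : ∀ x ∈ E, PointwiseRelations p h x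

/-- A conull set contains a measurable conull set invariant under rational affine maps. -/
theorem exists_invariant_conull {P : ℝ → Prop} (hP : ∀ᵐ x : ℝ, P x) :
    ∃ E : Set ℝ, MeasurableSet E ∧ (∀ᵐ x : ℝ, x ∈ E) ∧
      (∀ x ∈ E, ∀ a b : ℚ, a ≠ 0 → (a * x + b : ℝ) ∈ E) ∧ ∀ x ∈ E, P x := by
  obtain ⟨F, hFs, hFm, hF0⟩ := exists_measurable_superset_of_null (ae_iff.1 hP)
  refine ⟨{x | ∀ a b : ℚ, a ≠ 0 → (a * x + b : ℝ) ∉ F}, ?_, ?_, ?_, ?_⟩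
  · simp only [ofPred_forall]
    refine MeasurableSet.iInter fun a => MeasurableSet.iInter fun b => MeasurableSet.iInter fun _ => ?_
    exact (((measurable_const_mul (a : ℝ)).add_const (b : ℝ)) hFm).compl
  · simp only [mem_ofPred_eq, ae_all_iff]
    intro a b ha
    have hF1 : ∀ᵐ x : ℝ, x ∉ F := by simpa [ae_iff] using hF0
    exact ae_comp_affine hF1 (by exact_mod_cast ha) (b : ℝ)
  · intro x hx a b ha a' b' ha'
    have h := hx (a' * a) (a' * b + b') (mul_ne_zero ha' ha)
    push_cast at h
    convert h using 2
    ring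
  · intro x hx
    by_contra hc
    have h := hx 1 0 one_ne_zero
    simp only [Rat.cast_one, one_mul, Rat.cast_zero, add_zero] at h
    exact h (hFs hc)

/-! ### The set `S` of least points of the support of `p` -/

section Combinatorics

variable {p h : ℝ → ℂ} {E : Set ℝ}

theorem IsGoodSet.add_int_mem (hE : IsGoodSet p h E) {x : ℝ} (hx : x ∈ E) (k : ℤ) :
    x + k ∈ E := by
  simpa using hE.affine_mem x hx 1 k one_ne_zero

theorem IsGoodSet.two_mul_mem (hE : IsGoodSet p h E) {x : ℝ} (hx : x ∈ E) : 2 * x ∈ E := by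
  simpa using hE.affine_mem x hx 2 0 two_ne_zero

theorem IsGoodSet.half_mem (hE : IsGoodSet p h E) {x : ℝ} (hx : x ∈ E) : 2⁻¹ * x ∈ E := by
  simpa using hE.affine_mem x hx 2⁻¹ 0 (inv_ne_zero two_ne_zero)

theorem IsGoodSet.zpow_mul_mem (hE : IsGoodSet p h E) {x : ℝ} (hx : x ∈ E) (n : ℤ) :
    (2 : ℝ) ^ n * x ∈ E := by
  simpa using hE.affine_mem x hx (2 ^ n) 0 (zpow_ne_zero n two_ne_zero)

/-- A tie would force `x = -k / 2`, which is rational. This makes the least point of a coset unique.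
-/
theorem IsGoodSet.abs_ne (hE : IsGoodSet p h E) {x : ℝ} (hx : x ∈ E) {k : ℤ} (hk : k ≠ 0) :
    |x| ≠ |x + k| := by
  intro he
  rcases abs_eq_abs.1 he with h1 | h1
  · have h2 : (k : ℝ) = 0 := by linarith
    exact hk (by exact_mod_cast h2)
  · refine hE.irrational x hx ⟨-(k / 2), ?_⟩
    push_cast
    linarith

/-- The points of `E` of least absolute value among the points of their coset of `ℤ` at which `p`
does not vanish. -/
def leastSupport (p : ℝ → ℂ) (E : Set ℝ) : Set ℝ :=
  {x | x ∈ E ∧ p x ≠ 0 ∧ ∀ k : ℤ, p (x + k) ≠ 0 → |x| ≤ |x + k|}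

theorem measurableSet_leastSupport (hE : IsGoodSet p h E) (hp : Measurable p) :
    MeasurableSet (leastSupport p E) := by
  refine hE.measurableSet.inter (MeasurableSet.inter ?_ ?_)
  · exact (hp (measurableSet_singleton 0)).compl
  · change MeasurableSet {x : ℝ | ∀ k : ℤ, p (x + k) ≠ 0 → |x| ≤ |x + k|}
    simp only [ofPred_forall]
    refine MeasurableSet.iInter fun k => ?_
    have h1 : {x : ℝ | p (x + k) ≠ 0 → |x| ≤ |x + k|} =
        {x : ℝ | p (x + k) = 0} ∪ {x : ℝ | |x| ≤ |x + k|} := by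
      ext x
      simp only [mem_ofPred_eq, mem_union, ne_eq]
      tauto
    rw [h1]
    refine MeasurableSet.union ?_ ?_
    · exact (hp.comp (measurable_id.add_const (k : ℝ))) (measurableSet_singleton 0)
    · exact measurableSet_le measurable_id.abs (measurable_id.add_const (k : ℝ)).abs

theorem eq_of_add_int_mem_leastSupport (hE : IsGoodSet p h E) {x : ℝ} {k l : ℤ}
    (hk : x + k ∈ leastSupport p E) (hl : x + l ∈ leastSupport p E) : k = l := by
  by_contra hne
  have e1 : x + l = x + k + ((l - k : ℤ) : ℝ) := by push_cast; ring
  have e2 : x + k = x + l + ((k - l : ℤ) : ℝ) := by push_cast; ring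
  have h1 := hk.2.2 (l - k) (by rw [← e1]; exact hl.2.1)
  have h2 := hl.2.2 (k - l) (by rw [← e2]; exact hk.2.1)
  rw [← e1] at h1
  rw [← e2] at h2
  have h3 := hE.abs_ne hk.1 (k := l - k) (sub_ne_zero.2 (Ne.symm hne))
  rw [← e1] at h3
  exact h3 (le_antisymm h1 h2)

theorem exists_add_int_mem_leastSupport (hE : IsGoodSet p h E) {x : ℝ} (hx : x ∈ E) :
    ∃ k : ℤ, x + k ∈ leastSupport p E := by
  obtain ⟨k₀, hk₀⟩ := (hE.relations x hx).exists_ne_zero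
  set A : Set ℤ := {k | p (x + k) ≠ 0 ∧ |x + k| ≤ |x + k₀|} with hA
  have hfin : A.Finite := by
    refine (finite_Icc ⌊-|x + k₀| - x⌋ ⌈|x + k₀| - x⌉).subset fun k hk => ?_
    obtain ⟨h1, h2⟩ := abs_le.1 hk.2
    refine ⟨?_, ?_⟩
    · exact_mod_cast (Int.floor_le _).trans (by linarith : -|x + k₀| - x ≤ (k : ℝ))
    · exact_mod_cast (by linarith : (k : ℝ) ≤ |x + k₀| - x).trans (Int.le_ceil _)
  obtain ⟨k, hk, hmin⟩ := exists_min_image A (fun k : ℤ => |x + k|) hfin ⟨k₀, hk₀, le_rfl⟩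
  refine ⟨k, hE.add_int_mem hx k, hk.1, fun l hl => ?_⟩
  have e1 : x + k + (l : ℝ) = x + ((k + l : ℤ) : ℝ) := by push_cast; ring
  rw [e1] at hl ⊢
  rcases le_total |x + ((k + l : ℤ) : ℝ)| |x + k₀| with h1 | h1
  · exact hmin _ ⟨hl, h1⟩
  · exact hk.2.trans h1

theorem ne_zero_of_two_mul_ne_zero (hE : IsGoodSet p h E) {x : ℝ} (hx : x ∈ E)
    (h2 : p (2 * x) ≠ 0) : p x ≠ 0 := by
  intro h0
  obtain ⟨k, hk⟩ := (hE.relations x hx).exists_ne_zero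
  have h1 := (hE.relations x hx).scaling k
  rw [h0, zero_mul] at h1
  exact (mul_ne_zero hk h2) h1

/-- This is `S ⊆ 2S`: by the scaling relation, a competitor `x + k` of `x` doubles to a competitor
`2x + 2k` of `2x`. -/
theorem mem_leastSupport_of_two_mul_mem (hE : IsGoodSet p h E) {x : ℝ} (hx : x ∈ E)
    (h2 : 2 * x ∈ leastSupport p E) : x ∈ leastSupport p E := by
  have h0 := ne_zero_of_two_mul_ne_zero hE hx h2.2.1
  refine ⟨hx, h0, fun k hk => ?_⟩
  have h1 := (hE.relations x hx).scaling k
  have h3 : p (2 * x + (2 * k : ℤ)) ≠ 0 := by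
    intro h4
    rw [h4, mul_zero] at h1
    exact (mul_ne_zero hk h2.2.1) h1
  have h5 := h2.2.2 _ h3
  have h6 : 2 * x + ((2 * k : ℤ) : ℝ) = 2 * (x + k) := by push_cast; ring
  rw [h6, abs_mul, abs_mul] at h5
  exact le_of_mul_le_mul_left h5 (by norm_num)

theorem odd_shift_eq_zero (hE : IsGoodSet p h E) {x : ℝ} (hx : x ∈ E) (hp : p x ≠ 0)
    (hh : h (2 * x) = 0) (i : ℤ) : p (2 * x + (2 * i + 1 : ℤ)) = 0 := by
  have hx2 := hE.relations _ (hE.two_mul_mem hx)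
  refine eq_zero_of_bracket (a := fun k : ℤ => p (2 * x + k)) (b := fun k : ℤ => h (2 * x + k))
    (fun k => ?_) (fun i j => ?_) hx2.bracket_wavelet hx2.bracket_scaling i
  · have h1 := (hE.relations x hx).wavelet k
    rw [hh, mul_zero] at h1
    exact (mul_eq_zero.1 h1.symm).resolve_left hp
  -- Odd shifts of `2x` are even shifts of `2w` for `w` in the coset of `x + 1/2`. Choosing `p w ≠
  -- 0`, both `p` and `h` on `2w + 2ℤ` are multiples of `k ↦ p (w + k)`.
  · have hy : x + 2⁻¹ ∈ E := by simpa using hE.affine_mem x hx 1 2⁻¹ one_ne_zero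
    obtain ⟨l, hl⟩ := (hE.relations _ hy).exists_ne_zero
    have hw := hE.relations _ (hE.add_int_mem hy l)
    set w : ℝ := x + 2⁻¹ + l with hw0
    have e : ∀ i : ℤ, 2 * x + ((2 * i + 1 : ℤ) : ℝ) = 2 * w + ((2 * (i - l) : ℤ) : ℝ) := fun i => by
      rw [hw0]
      push_cast
      ring
    have s := fun i : ℤ => hw.scaling (i - l)
    have t := fun i : ℤ => hw.wavelet (i - l)
    simp only [← e] at s t
    -- Each of `p` and `h` is expressed through `p (w + ·)` at the cost of one factor `p w`, hence
    -- two cancellations.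
    apply mul_left_cancel₀ hl
    apply mul_left_cancel₀ hl
    linear_combination (-(p w * h (2 * x + (2 * j + 1 : ℤ)))) * s i
      - p (w + (i - l : ℤ)) * p (2 * w) * t j
      + (p w * h (2 * x + (2 * i + 1 : ℤ))) * s j + p (w + (j - l : ℤ)) * p (2 * w) * t i

theorem two_mul_mem_leastSupport (hE : IsGoodSet p h E) {x : ℝ} (hx : x ∈ leastSupport p E)
    (hh : h (2 * x) = 0) : 2 * x ∈ leastSupport p E := by
  have hR := hE.relations x hx.1
  have hev : ∀ m : ℤ, p (2 * x + m) ≠ 0 → ∃ k : ℤ, m = 2 * k := fun m hm => by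
    obtain ⟨k, rfl | rfl⟩ := m.even_or_odd'
    · exact ⟨k, rfl⟩
    · exact absurd (odd_shift_eq_zero hE hx.1 hx.2.1 hh k) hm
  have hne : ∀ k : ℤ, p (2 * x + (2 * k : ℤ)) ≠ 0 → p (x + k) * p (2 * x) ≠ 0 := fun k hk => by
    rw [hR.scaling k]
    exact mul_ne_zero hx.2.1 hk
  refine ⟨hE.two_mul_mem hx.1, ?_, fun m hm => ?_⟩
  · obtain ⟨m, hm⟩ := (hE.relations _ (hE.two_mul_mem hx.1)).exists_ne_zero
    obtain ⟨k, rfl⟩ := hev m hm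
    exact right_ne_zero_of_mul (hne k hm)
  · obtain ⟨k, rfl⟩ := hev m hm
    have h1 := hx.2.2 k (left_ne_zero_of_mul (hne k hm))
    have h6 : 2 * x + ((2 * k : ℤ) : ℝ) = 2 * (x + k) := by push_cast; ring
    rw [h6, abs_mul, abs_mul]
    exact mul_le_mul_of_nonneg_left h1 (abs_nonneg _)

/-- The periodized indicator of `S` is at most one, because a coset meets `S` at most once. -/
theorem volume_leastSupport_le (hE : IsGoodSet p h E) (hp : Measurable p) :
    volume (leastSupport p E) ≤ 1 := by
  have hm := measurableSet_leastSupport hE hp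
  rw [← lintegral_indicator_one hm, lintegral_eq_tsum_Ioc, ← lintegral_tsum]
  · have h1 : ∀ x : ℝ, ∑' n : ℤ, (leastSupport p E).indicator (1 : ℝ → ENNReal) (x + n) ≤ 1 := by
      intro x
      by_cases hx : ∃ k : ℤ, x + k ∈ leastSupport p E
      · obtain ⟨k, hk⟩ := hx
        rw [tsum_eq_single k fun l hl => indicator_of_notMem
          (fun hl2 => hl (eq_of_add_int_mem_leastSupport hE hl2 hk)) _]
        exact indicator_le_self' (fun _ _ => zero_le) _
      · push Not at hx
        simp [hx]
    calc _ ≤ ∫⁻ x in Ioc (0 : ℝ) 1, 1 := lintegral_mono h1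
      _ = 1 := by simp
  · exact fun n => ((measurable_one.indicator hm).comp (measurable_id.add_const _)).aemeasurable

theorem ae_exists_pow_mul_notMem (hE : IsGoodSet p h E) (hp : Measurable p) :
    ∀ᵐ x : ℝ, ∃ n : ℕ, (2 : ℝ) ^ n * x ∉ leastSupport p E := by
  rw [ae_iff]
  push Not
  have h1 : ∀ n : ℕ, volume {x : ℝ | ∀ n : ℕ, (2 : ℝ) ^ n * x ∈ leastSupport p E} ≤
      ENNReal.ofReal ((1 / 2 : ℝ) ^ n) := by
    intro n
    calc _ ≤ volume ((fun x : ℝ => (2 : ℝ) ^ n * x) ⁻¹' leastSupport p E) :=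
          measure_mono fun x (hx : ∀ n : ℕ, (2 : ℝ) ^ n * x ∈ leastSupport p E) => hx n
      _ = ENNReal.ofReal |((2 : ℝ) ^ n)⁻¹| * volume (leastSupport p E) :=
          Real.volume_preimage_mul_left (pow_ne_zero _ two_ne_zero) _
      _ ≤ ENNReal.ofReal |((2 : ℝ) ^ n)⁻¹| * 1 := by
          gcongr
          exact volume_leastSupport_le hE hp
      _ = _ := by rw [mul_one, abs_of_nonneg (by positivity), one_div, inv_pow]
  refine le_antisymm (ge_of_tendsto' (x := atTop) ?_ h1) zero_le
  rw [← ENNReal.ofReal_zero]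
  exact ENNReal.tendsto_ofReal
    (tendsto_pow_atTop_nhds_zero_of_lt_one (by norm_num) (by norm_num))

/-- Once `p` is nonzero at some `2 ^ (-n) x`, it stays nonzero under further halving; a point of
absolute value at most `1/2` is automatically least in its coset. -/
theorem exists_zpow_mul_mem_leastSupport (hE : IsGoodSet p h E) {x : ℝ} (hx : x ∈ E) :
    ∃ n : ℤ, (2 : ℝ) ^ n * x ∈ leastSupport p E := by
  obtain ⟨n, hn⟩ := (hE.relations x hx).exists_dilate_ne_zero
  have h1 : ∀ m : ℕ, p ((2 : ℝ) ^ (-((n + m : ℕ) : ℤ)) * x) ≠ 0 := by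
    intro m
    induction m with
    | zero => simpa using hn
    | succ m ih =>
      refine ne_zero_of_two_mul_ne_zero hE (hE.zpow_mul_mem hx _) ?_
      rw [← mul_assoc, ← zpow_one_add₀ two_ne_zero]
      convert ih using 4
      push_cast
      ring
  obtain ⟨m, hm⟩ := pow_unbounded_of_one_lt (2 * |x|) (one_lt_two (α := ℝ))
  refine ⟨-((n + m : ℕ) : ℤ), hE.zpow_mul_mem hx _, h1 m, fun k _ => ?_⟩
  have h2 : |(2 : ℝ) ^ (-((n + m : ℕ) : ℤ)) * x| ≤ 1 / 2 := by
    rw [abs_mul, abs_of_pos (by positivity), zpow_neg, zpow_natCast, inv_mul_le_iff₀ (by positivity),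
      pow_add]
    have h3 : (1 : ℝ) ≤ 2 ^ n := one_le_pow₀ one_le_two
    have h4 : (0 : ℝ) < 2 ^ m := by positivity
    nlinarith
  rcases eq_or_ne k 0 with rfl | hk
  · simp
  · have h3 : (1 : ℝ) ≤ |(k : ℝ)| := by exact_mod_cast Int.one_le_abs hk
    have h4 := abs_sub_abs_le_abs_sub (k : ℝ) (-((2 : ℝ) ^ (-((n + m : ℕ) : ℤ)) * x))
    rw [abs_neg, sub_neg_eq_add, add_comm (k : ℝ)] at h4
    linarith

/-! ### The wavelet set `2S \ S` -/

/-- The set `2S \\ S`, where `S = leastSupport p E`. -/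
def minimalWaveletSet (p : ℝ → ℂ) (E : Set ℝ) : Set ℝ :=
  {x | 2⁻¹ * x ∈ leastSupport p E ∧ x ∉ leastSupport p E}

theorem existsUnique_add_int_mem (hE : IsGoodSet p h E) {x : ℝ} (hx : x ∈ E) :
    ∃! k : ℤ, x + k ∈ minimalWaveletSet p E := by
  obtain ⟨m, hm⟩ := exists_add_int_mem_leastSupport hE hx
  obtain ⟨a, ha⟩ := exists_add_int_mem_leastSupport hE (hE.half_mem hx)
  -- Halving sends the even shifts of `x` to the coset of `x / 2` and the odd ones to that of `(x +
  -- 1) / 2`; each contains one point of `S`.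
  have hy : 2⁻¹ * (x + 1) ∈ E := hE.half_mem (by simpa using hE.add_int_mem hx 1)
  obtain ⟨b, hb⟩ := exists_add_int_mem_leastSupport hE hy
  have key : ∀ k : ℤ, 2⁻¹ * (x + k) ∈ leastSupport p E ↔ k = 2 * a ∨ k = 2 * b + 1 := by
    intro k
    have e1 : ∀ c : ℤ, 2⁻¹ * (x + (2 * c : ℤ)) = 2⁻¹ * x + c := fun c => by push_cast; ring
    have e2 : ∀ c : ℤ, 2⁻¹ * (x + (2 * c + 1 : ℤ)) = 2⁻¹ * (x + 1) + c := fun c => by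
      push_cast; ring
    constructor
    · intro hk
      obtain ⟨c, rfl | rfl⟩ := k.even_or_odd'
      · rw [e1] at hk
        exact Or.inl (by rw [eq_of_add_int_mem_leastSupport hE hk ha])
      · rw [e2] at hk
        exact Or.inr (by rw [eq_of_add_int_mem_leastSupport hE hk hb])
    · rintro (rfl | rfl)
      · rwa [e1]
      · rwa [e2]
  have key2 : ∀ k : ℤ, x + k ∈ leastSupport p E ↔ k = m := fun k =>
    ⟨fun hk => eq_of_add_int_mem_leastSupport hE hk hm, fun hk => hk ▸ hm⟩
  have hm2 : m = 2 * a ∨ m = 2 * b + 1 := (key m).1 <| by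
    refine mem_leastSupport_of_two_mul_mem hE (hE.half_mem (hE.add_int_mem hx m)) ?_
    rwa [mul_inv_cancel_left₀ two_ne_zero]
  have key3 : ∀ k : ℤ, x + k ∈ minimalWaveletSet p E ↔ (k = 2 * a ∨ k = 2 * b + 1) ∧ k ≠ m :=
    fun k => and_congr (key k) (not_congr (key2 k))
  simp only [key3]
  rcases hm2 with rfl | rfl
  · exact ⟨2 * b + 1, by simp; omega, fun k hk => by omega⟩
  · exact ⟨2 * a, by simp; omega, fun k hk => by omega⟩

/-- The exponents `n` with `2 ^ n x ∈ S` form a nonempty down-set bounded above; `2 ^ n x` lies in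
`W` exactly when `n` is one more than its greatest element. -/
theorem existsUnique_zpow_mul_mem (hE : IsGoodSet p h E) {x : ℝ} (hx : x ∈ E)
    (hn : ∃ n : ℕ, (2 : ℝ) ^ n * x ∉ leastSupport p E) :
    ∃! j : ℤ, (2 : ℝ) ^ (-j) * x ∈ minimalWaveletSet p E := by
  set Q : ℤ → Prop := fun n => (2 : ℝ) ^ n * x ∈ leastSupport p E with hQ
  have hstep : ∀ n, Q (n + 1) → Q n := fun n hq => by
    refine mem_leastSupport_of_two_mul_mem hE (hE.zpow_mul_mem hx _) ?_
    rwa [← mul_assoc, ← zpow_one_add₀ two_ne_zero, add_comm]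
  have hanti : ∀ m n, m ≤ n → Q n → Q m := fun m n hmn =>
    Int.leInduction (m := m) (motive := fun n _ => Q n → Q m) id
      (fun n _ ih hq => ih (hstep n hq)) n hmn
  have hW : ∀ j : ℤ, (2 : ℝ) ^ (-j) * x ∈ minimalWaveletSet p E ↔ Q (-j - 1) ∧ ¬ Q (-j) := by
    intro j
    refine and_congr ?_ Iff.rfl
    have h1 : (2 : ℝ) ^ (-j - 1) * x = 2⁻¹ * ((2 : ℝ) ^ (-j) * x) := by
      rw [zpow_sub_one₀ (two_ne_zero (α := ℝ))]
      ring
    rw [hQ, ← h1]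
  obtain ⟨N, hN⟩ := hn
  have hN' : ¬ Q N := by simpa [hQ] using hN
  obtain ⟨n, hn1, hn2⟩ := Int.exists_greatest_of_bdd (P := Q)
    ⟨N, fun z hz => by
      by_contra! hc
      exact hN' (hanti _ _ hc.le hz)⟩ (exists_zpow_mul_mem_leastSupport hE hx)
  refine ⟨-(n + 1), (hW _).2 ⟨by simpa using hn1, fun hq => ?_⟩, fun j hj => ?_⟩
  · have := hn2 _ hq
    omega
  · obtain ⟨h1, h2⟩ := (hW j).1 hj
    have h3 := hn2 _ h1
    have h4 : ¬ (-j ≤ n) := fun h5 => h2 (hanti _ _ h5 hn1)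
    omega

theorem isWaveletSet_minimalWaveletSet (hE : IsGoodSet p h E) (hp : Measurable p) :
    IsWaveletSet (minimalWaveletSet p E) := by
  have hm := measurableSet_leastSupport hE hp
  refine ⟨((measurable_const_mul (2⁻¹ : ℝ)) hm).inter hm.compl,
    isPartitionModNull_of_ae_existsUnique ?_, isPartitionModNull_of_ae_existsUnique ?_⟩
  · filter_upwards [hE.ae_mem] with x hx
    refine ((Equiv.neg ℤ).existsUnique_congr fun {k} => ?_).1 (existsUnique_add_int_mem hE hx)
    simp
  · filter_upwards [hE.ae_mem, ae_exists_pow_mul_notMem hE hp] with x hx hn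
    refine (existsUnique_congr fun j => ?_).1 (existsUnique_zpow_mul_mem hE hx hn)
    have h2 : (2 : ℝ) ^ j ≠ 0 := zpow_ne_zero j two_ne_zero
    rw [zpow_neg]
    constructor
    · exact fun hj => ⟨_, hj, mul_inv_cancel_left₀ h2 x⟩
    · rintro ⟨y, hy, rfl⟩
      simpa [inv_mul_cancel_left₀ h2] using hy

theorem ne_zero_of_mem_minimalWaveletSet (hE : IsGoodSet p h E) {x : ℝ}
    (hx : x ∈ minimalWaveletSet p E) : h x ≠ 0 := by
  intro h0
  have h1 := two_mul_mem_leastSupport hE hx.1 (by rwa [mul_inv_cancel_left₀ two_ne_zero])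
  rw [mul_inv_cancel_left₀ two_ne_zero] at h1
  exact hx.2 h1

end Combinatorics

theorem ae_irrational : ∀ᵐ x : ℝ, Irrational x :=
  (countable_range ((↑) : ℚ → ℝ)).ae_notMem volume

end WaveletTheory

end

/-- An element of `L²(ℝ)` is a class of functions modulo null sets, so the inclusion of a wavelet
set in the frequency support is asserted for every function `g` representing the Fourier
transform of `ψ` (normalized with the kernel `exp (-2 π i x ξ)`). -/
theorem theorem2p9 (ψ : WaveletTheory.L2R) (hψ : WaveletTheory.IsMRAWavelet ψ)
    (g : ℝ → ℂ) (hg : g =ᵐ[volume] (𝓕 ψ : WaveletTheory.L2R)) :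
    ∃ W : Set ℝ, WaveletTheory.IsWaveletSet W ∧ W ⊆ {ξ : ℝ | g ξ ≠ 0} := by
  obtain ⟨p, hp, hrel⟩ := WaveletTheory.exists_pointwiseRelations hψ
  have hae : ∀ᵐ x : ℝ, (Irrational x ∧ g x = (𝓕 ψ : WaveletTheory.L2R) x) ∧
      WaveletTheory.PointwiseRelations p (𝓕 ψ : WaveletTheory.L2R) x :=
    (WaveletTheory.ae_irrational.and hg).and hrel
  obtain ⟨E, hE1, hE2, hE3, hE4⟩ := WaveletTheory.exists_invariant_conull hae
  have hE : WaveletTheory.IsGoodSet p (𝓕 ψ : WaveletTheory.L2R) E :=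
    ⟨hE1, hE2, hE3, fun x hx => (hE4 x hx).1.1, fun x hx => (hE4 x hx).2⟩
  refine ⟨WaveletTheory.minimalWaveletSet p E,
    WaveletTheory.isWaveletSet_minimalWaveletSet hE hp, fun x hx => ?_⟩
  -- `W` lies inside `E`, where `g` agrees with `ψ̂` at every point, so the inclusion holds without
  -- exceptional null set.
  have hxE : x ∈ E := by simpa using hE.two_mul_mem hx.1.1
  rw [Set.mem_ofPred_eq, (hE4 x hxE).1.2]
  exact WaveletTheory.ne_zero_of_mem_minimalWaveletSet hE hx
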